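/- **Lower bound for deep rectifier networks.** Let $L\ge 1$, $n_0\ge 1$, and let $n_1,\dots,n_L$ be integers with $n_i\ge n_0$ for all $i\in\{1,\dots,L\}$. If $\lfloor n_i/n_0\rfloor\ge 2$ for some $i\le L-1$, assume in addition that $n_L>n_0$. A rectifier network with $n_0$ inputs and $L$ hidden layers of widths $n_1,\dots,n_L$ has parameters $W_l\in\mathbb R^{n_l\times n_{l-1}}$, $b_l\in\mathbb R^{n_l}$ ($1\le l\le L$). Its hidden activations are $F_0(x)=x$ for $x\in\mathbb R^{n_0}$ and $F_l(x)=\max\{0,\,W_lF_{l-1}(x)+b_l\}$ (coordinatewise maximum). With an output layer $A\in\mathbb R^{m\times n_L}$, $c\in\mathbb R^m$, it computes $x\mapsto A F_L(x)+c$. A *linear region* of a function $F:\mathbb R^{n_0}\to\mathbb R^m$ is a maximal connected set $S\subseteq\mathbb R^{n_0}$ on which $F$ coincides with some affine map, where $S$ is also required to have nonempty interior. Put $$N=\Bigl(\prod_{i=1}^{L-1}\Bigl\lfloor\frac{n_i}{n_0}\Bigr\rfloor^{n_0}\Bigr)\sum_{j=0}^{n_0}\binom{n_L}{j}.$$ Then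 there are parameters $(W_l,b_l)_{1\le l\le L}$ such that $F_L:\mathbb R^{n_0}\to\mathbb R^{n_L}$ has at least $N$ linear regions and, moreover, for every output dimension $m\ge 1$ there are $A,c$ such that the network function $x\mapsto A F_L(x)+c$ has at least $N$ linear regions. -/

import Mathlib

open scoped Matrix

/-- The activation of a layer of rectifier units: `max {0, a}` in every coordinate. -/
noncomputable def rectifier {k : ℕ} (a : Fin k → ℝ) : Fin k → ℝ :=
  fun i => max 0 (a i)

/-- Parameters of the hidden layers of a network with widths `n 0, n 1, n 2, …` (`n 0` being the
number of inputs): `W l` and `b l` are the input weights and the bias vector of hidden layer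
`l + 1`. A network with `L` hidden layers only uses the entries with `l < L`. -/
structure HiddenParams (n : ℕ → ℕ) where
  W : (l : ℕ) → Matrix (Fin (n (l + 1))) (Fin (n l)) ℝ
  b : (l : ℕ) → Fin (n (l + 1)) → ℝ

/-- The activations of the `l`-th hidden layer as a function of the network input
(layer `0` is the input itself). -/
noncomputable def HiddenParams.activation {n : ℕ → ℕ} (θ : HiddenParams n) :
    (l : ℕ) → (Fin (n 0) → ℝ) → (Fin (n l) → ℝ)
  | 0, x => x
  | l + 1, x => rectifier (θ.W l *ᵥ θ.activation l x + θ.b l)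

/-- The function computed by the network with `L` hidden layers of rectifiers followed by the
linear output layer with weights `A` and bias `c`. -/
noncomputable def HiddenParams.networkFun {n : ℕ → ℕ} (θ : HiddenParams n) (L : ℕ) {m : ℕ}
    (A : Matrix (Fin m) (Fin (n L)) ℝ) (c : Fin m → ℝ) (x : Fin (n 0) → ℝ) : Fin m → ℝ :=
  A *ᵥ θ.activation L x + c

/-- `F` is linear (in the sense of piecewise linear functions, that is, affine) on `S`. -/
def IsLinearOn {d m : ℕ} (F : (Fin d → ℝ) → (Fin m → ℝ)) (S : Set (Fin d → ℝ)) : Prop :=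
  ∃ g : (Fin d → ℝ) →ᵃ[ℝ] (Fin m → ℝ), Set.EqOn F g S

/-- A linear region of `F` is a maximal connected subset of the input space on which `F` is
linear, of full dimension. The dimension condition discards spurious thin sets, such as the bent
line `{(x, y) | y = max 0 x}`, on which `(x, y) ↦ max 0 x` agrees with the affine map
`(x, y) ↦ y`. -/
def IsLinearRegion {d m : ℕ} (F : (Fin d → ℝ) → (Fin m → ℝ)) (S : Set (Fin d → ℝ)) : Prop :=
  Maximal (fun T : Set (Fin d → ℝ) => IsConnected T ∧ IsLinearOn F T) S ∧ (interior S).Nonempty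

/-- The number of linear regions of `F`. -/
noncomputable def numLinearRegions {d m : ℕ} (F : (Fin d → ℝ) → (Fin m → ℝ)) : ℕ∞ :=
  {S : Set (Fin d → ℝ) | IsLinearRegion F S}.encard

/-!
A linear region with nonempty interior determines its affine map, so a function has at least as many
linear regions as there are affine maps with which it agrees near some point
(`card_le_numLinearRegions`). It is therefore enough to find a linear combination of the units of
the last hidden layer with `N` distinct local affine pieces: the layer itself then has at least as
many, and so has the network all of whose outputs are that combination.

Write `d` for the number of inputs and `p_i = ⌊n_i / d⌋`. A layer of `d * p` rectifiers computes, up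
to a linear readout, the map that applies a zigzag function of `p` pieces to every coordinate and
folds the `p ^ d` small cubes of a grid onto the unit cube (`exists_layer_eq_fold`). The readout is
merged into the next layer. The composition of the foldings of the first `L - 1` layers maps `∏ p_i
^ d` parts of the cube onto the whole cube, each by its own affine bijection
(`encard_cubePieces_comp`, `prod_le_encard_cubePieces_iteratedFold`).

The last layer divides the cube into `∑ j ≤ d, (n_L choose j)` cells, one for each sign pattern with
at most `d` sign changes of a monic polynomial of degree `d` at `n_L` nodes. Pulling back by the
affine bijections gives `N` cells in the input space. Two of them have different tuples of affine
pieces of the units: either their sets of active units differ, or they lie in different parts of the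
cube and, the nodes being generic, every active unit distinguishes these parts. In the second case
an active unit is needed; for `n_L > d` the alternating pattern does not occur, and the units are
oriented so that this is the pattern on which all would be inactive (`exists_last_layer`). Finally,
a generic linear combination of the units keeps the `N` tuples apart (`exists_injective_sum_smul`).
-/

open scoped Topology

/-! ### Linear regions and affine germs -/

theorem AffineMap.eq_of_eventuallyEq_nhds {d m : ℕ} {g h : (Fin d → ℝ) →ᵃ[ℝ] (Fin m → ℝ)}
    {x : Fin d → ℝ} (hgh : g =ᶠ[𝓝 x] h) : g = h := by
  obtain ⟨U, hU, hUo, hxU⟩ := mem_nhds_iff.1 hgh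
  exact AffineMap.ext_on (hUo.affineSpan_eq_top ⟨x, hxU⟩) hU

/-- Every affine map that agrees with `F` near a point gives a linear region, namely the connected
component of that point in the set where the two agree; distinct affine maps give distinct regions
because an affine map is determined by its values on an open set. -/
theorem card_le_numLinearRegions {d m : ℕ} {F : (Fin d → ℝ) → (Fin m → ℝ)} {κ : Type*}
    (G : κ → (Fin d → ℝ) →ᵃ[ℝ] (Fin m → ℝ)) (hG : Function.Injective G)
    (hF : ∀ k, ∃ x, F =ᶠ[𝓝 x] G k) : ENat.card κ ≤ numLinearRegions F := by
  choose x hx using hF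
  have hball : ∀ k, ∃ r > 0, Metric.ball (x k) r ⊆ {y | F y = G k y} := fun k =>
    Metric.mem_nhds_iff.1 (hx k)
  choose r hr hrs using hball
  let S : κ → Set (Fin d → ℝ) := fun k => connectedComponentIn {y | F y = G k y} (x k)
  have hSeq : ∀ k, Set.EqOn F (G k) (S k) := fun k y hy =>
    connectedComponentIn_subset {y | F y = G k y} (x k) hy
  have hxS : ∀ k, Metric.ball (x k) (r k) ⊆ S k := fun k =>
    (convex_ball (x k) (r k)).isPreconnected.subset_connectedComponentIn
      (Metric.mem_ball_self (hr k)) (hrs k)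
  have key : ∀ k T (g : (Fin d → ℝ) →ᵃ[ℝ] (Fin m → ℝ)), S k ⊆ T → Set.EqOn F g T → g = G k := by
    intro k T g hST hg
    refine AffineMap.eq_of_eventuallyEq_nhds (x := x k) ?_
    filter_upwards [Metric.ball_mem_nhds (x k) (hr k)] with y hy
    rw [← hg (hST (hxS k hy)), hSeq k (hxS k hy)]
  have hreg : ∀ k, IsLinearRegion F (S k) := by
    intro k
    refine ⟨⟨⟨isConnected_connectedComponentIn_iff.2 (hrs k (Metric.mem_ball_self (hr k))),
      G k, hSeq k⟩, ?_⟩, ?_⟩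
    · rintro T ⟨hTc, g, hg⟩ hST
      obtain rfl := key k T g hST hg
      exact hTc.isPreconnected.subset_connectedComponentIn
        (hST (hxS k (Metric.mem_ball_self (hr k)))) hg
    · exact ⟨x k, mem_interior.2 ⟨_, hxS k, Metric.isOpen_ball, Metric.mem_ball_self (hr k)⟩⟩
  have hSinj : Function.Injective S := fun k l hkl =>
    hG (key l (S k) (G k) hkl.ge (hSeq k))
  rw [numLinearRegions, ← Set.encard_univ, ← hSinj.encard_image, Set.image_univ]
  exact Set.encard_le_encard (Set.range_subset_iff.2 hreg)

/-! ### Folding maps -/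

/-- The open unit cube. -/
def openCube (d : ℕ) : Set (Fin d → ℝ) := {y | ∀ j, y j ∈ Set.Ioo (0 : ℝ) 1}

/-- The affine bijections `g` for which `Φ` maps `g⁻¹(openCube d)`, a part of the open unit cube,
onto the whole open unit cube in the way `g` does; in fact `Φ` agrees with `g` near each point of
this part. -/
def cubePieces {d : ℕ} (Φ : (Fin d → ℝ) → (Fin d → ℝ)) : Set ((Fin d → ℝ) ≃ᵃ[ℝ] (Fin d → ℝ)) :=
  {g | ∀ x, g x ∈ openCube d → x ∈ openCube d ∧ Φ =ᶠ[𝓝 x] g}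

theorem AffineEquiv.continuous_pi {d : ℕ} (g : (Fin d → ℝ) ≃ᵃ[ℝ] (Fin d → ℝ)) : Continuous g :=
  AffineMap.continuous_of_finiteDimensional g.toAffineMap

theorem AffineEquiv.eq_of_eventuallyEq_nhds {d : ℕ} {g h : (Fin d → ℝ) ≃ᵃ[ℝ] (Fin d → ℝ)}
    {x : Fin d → ℝ} (hgh : g =ᶠ[𝓝 x] h) : g = h :=
  AffineEquiv.toAffineMap_injective
    (AffineMap.eq_of_eventuallyEq_nhds (g := g.toAffineMap) (h := h.toAffineMap) hgh)

/-- The numbers of pieces multiply under composition. A composite piece determines its two factors: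
the point over a given `y` determines the germ of the inner map, hence its piece. -/
theorem encard_cubePieces_comp {d : ℕ} (Ψ Φ : (Fin d → ℝ) → (Fin d → ℝ)) :
    (cubePieces Ψ).encard * (cubePieces Φ).encard ≤ (cubePieces (Ψ ∘ Φ)).encard := by
  rw [← Set.encard_prod]
  refine Set.encard_le_encard_of_injOn (f := fun q => q.2.trans q.1) ?_ ?_
  · rintro ⟨h, g⟩ ⟨hh, hg⟩ x hx
    obtain ⟨h1, h2⟩ := hh (g x) hx
    obtain ⟨h3, h4⟩ := hg x h1
    refine ⟨h3, ?_⟩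
    filter_upwards [h4, (AffineEquiv.continuous_pi g).continuousAt.eventually h2] with y hy1 hy2
    simp only [Function.comp_apply, AffineEquiv.trans_apply, hy1]
    exact hy2
  · rintro ⟨h, g⟩ ⟨hh, hg⟩ ⟨h', g'⟩ ⟨hh', hg'⟩ heq
    have heq' : ∀ z, h (g z) = h' (g' z) := fun z => DFunLike.congr_fun heq z
    let y : Fin d → ℝ := fun _ => 1 / 2
    have hy : y ∈ openCube d := fun j => by norm_num [y]
    let x := g.symm (h.symm y)
    have hx : h (g x) = y := by simp [x]
    have e1 := (hg x (hh (g x) (by rw [hx]; exact hy)).1).2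
    have e2 := (hg' x (hh' (g' x) (by rw [← heq', hx]; exact hy)).1).2
    obtain rfl : g = g' := AffineEquiv.eq_of_eventuallyEq_nhds (e1.symm.trans e2)
    have : h = h' := by
      ext1 z
      simpa using heq' (g.symm z)
    rw [this]

/-- A sum of `p` rectifiers of a real variable, which for each `k < p` maps `[k/p, (k+1)/p]` onto
`[0, 1]` with slope `±p`. -/
noncomputable def zigzag (p : ℕ) (s : ℝ) : ℝ :=
  ∑ k ∈ Finset.range p, (if k = 0 then (p : ℝ) else 2 * p * (-1) ^ k) * max 0 (s - k / p)

theorem zigzag_eq {p k : ℕ} (hk : k < p) {s : ℝ} (h1 : (k : ℝ) ≤ p * s) (h2 : p * s ≤ k + 1) :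
    zigzag p s = (-1) ^ k * (p * s - k - 1 / 2) + 1 / 2 := by
  have hp : (0 : ℝ) < p := by exact_mod_cast (by omega : 0 < p)
  have hpart : ∀ m : ℕ, ∑ i ∈ Finset.range (m + 1),
      (if i = 0 then (p : ℝ) else 2 * p * (-1) ^ i) * (s - i / p)
        = (-1) ^ m * (p * s - m - 1 / 2) + 1 / 2 := by
    intro m
    induction m with
    | zero => simp
    | succ m ih =>
      rw [Finset.sum_range_succ, ih, if_neg (Nat.succ_ne_zero m)]
      field_simp
      push_cast
      ring
  rw [← hpart k, zigzag, ← Finset.sum_subset (Finset.range_subset_range.2 hk)]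
  · refine Finset.sum_congr rfl fun i hi => ?_
    have hik : (i : ℝ) ≤ k := by exact_mod_cast (by simpa [Nat.lt_succ_iff] using hi)
    rw [max_eq_right]
    rw [sub_nonneg, div_le_iff₀ hp]
    linarith
  · intro i _ hi
    have hik : (k : ℝ) + 1 ≤ i := by exact_mod_cast (by simpa using hi : k + 1 ≤ i)
    rw [max_eq_left, mul_zero]
    rw [sub_nonpos, le_div_iff₀ hp]
    linarith

/-- The zigzag function applied to every coordinate: it folds the unit cube, which is cut into
`p ^ d` small cubes, onto itself. -/
noncomputable def fold (d p : ℕ) (y : Fin d → ℝ) : Fin d → ℝ := fun j => zigzag p (y j)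

theorem le_encard_cubePieces_fold (d p : ℕ) (hd : 1 ≤ d) :
    ((p ^ d : ℕ) : ℕ∞) ≤ (cubePieces (fold d p)).encard := by
  rcases Nat.eq_zero_or_pos p with rfl | hp
  · rw [zero_pow (by omega)]
    simp
  have hp' : (0 : ℝ) < p := by exact_mod_cast hp
  have hc : ∀ (k : Fin d → Fin p) (j : Fin d), ((-1 : ℝ) ^ (k j : ℕ) * p) ≠ 0 := fun k j =>
    mul_ne_zero (pow_ne_zero _ (by norm_num)) hp'.ne'
  let g : (Fin d → Fin p) → ((Fin d → ℝ) ≃ᵃ[ℝ] (Fin d → ℝ)) := fun k =>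
    (LinearEquiv.piCongrRight fun j =>
      LinearEquiv.smulOfNeZero ℝ ℝ _ (hc k j)).toAffineEquiv.trans
    (AffineEquiv.constVAdd ℝ (Fin d → ℝ) fun j => 1 / 2 - (-1) ^ (k j : ℕ) * ((k j : ℕ) + 1 / 2))
  have hg : ∀ k x j, g k x j = (-1) ^ (k j : ℕ) * (p * x j - (k j : ℕ) - 1 / 2) + 1 / 2 := by
    intro k x j
    simp [g]
    ring
  have hginj : Function.Injective g := by
    intro k k' hkk
    funext j
    have h1 := hg k (fun j => ((k j : ℕ) + 1 / 2) / p) j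
    have h2 := hg k' (fun j => ((k j : ℕ) + 1 / 2) / p) j
    rw [← hkk, h1, mul_div_cancel₀ _ hp'.ne'] at h2
    have h3 : ((-1 : ℝ) ^ (k' j : ℕ)) * ((k j : ℕ) - (k' j : ℕ) : ℝ) = 0 := by linarith
    have h4 := (mul_eq_zero.1 h3).resolve_left (pow_ne_zero _ (by norm_num))
    exact Fin.ext (by exact_mod_cast (sub_eq_zero.1 h4))
  have hmem : ∀ k, g k ∈ cubePieces (fold d p) := by
    intro k x hx
    have hkx : ∀ j, ((k j : ℕ) : ℝ) < p * x j ∧ p * x j < (k j : ℕ) + 1 := by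
      intro j
      have := hx j
      rw [hg, Set.mem_Ioo] at this
      rcases neg_one_pow_eq_or ℝ (k j : ℕ) with h | h <;> rw [h] at this <;>
        constructor <;> linarith [this.1, this.2]
    have hkp : ∀ j, ((k j : ℕ) : ℝ) + 1 ≤ p := fun j => by exact_mod_cast (k j).2
    refine ⟨fun j => ⟨?_, ?_⟩, ?_⟩
    · exact pos_of_mul_pos_right ((Nat.cast_nonneg _).trans_lt (hkx j).1) hp'.le
    · have := (hkx j).2.trans_le (hkp j)
      nlinarith
    · have h1 : ∀ j, ∀ᶠ y : Fin d → ℝ in 𝓝 x,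
          ((k j : ℕ) : ℝ) < (p : ℝ) * y j ∧ (p : ℝ) * y j < (k j : ℕ) + 1 := by
        intro j
        have hcont : Continuous fun y : Fin d → ℝ => (p : ℝ) * y j := by fun_prop
        exact (hcont.continuousAt.eventually_const_lt (hkx j).1).and
          (hcont.continuousAt.eventually_lt_const (hkx j).2)
      filter_upwards [Filter.eventually_all.2 h1] with y hy
      funext j
      rw [hg, fold, zigzag_eq (k j).2 (hy j).1.le (hy j).2.le]
  calc ((p ^ d : ℕ) : ℕ∞) = ENat.card (Fin d → Fin p) := by simp
    _ = (Set.range g).encard := by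
      rw [← Set.encard_univ, ← hginj.encard_image, Set.image_univ]
    _ ≤ _ := Set.encard_le_encard (Set.range_subset_iff.2 hmem)

/-- A layer of at least `d * p` rectifiers can compute the folding map, up to a linear readout. -/
theorem exists_layer_eq_fold {d p n : ℕ} (h : d * p ≤ n) :
    ∃ (W : Matrix (Fin n) (Fin d) ℝ) (b : Fin n → ℝ) (B : Matrix (Fin d) (Fin n) ℝ),
      ∀ y, B *ᵥ rectifier (W *ᵥ y + b) = fold d p y := by
  classical
  rcases isEmpty_or_nonempty (Fin d × Fin p) with hE | hE
  · refine ⟨0, 0, 0, fun y => funext fun j => ?_⟩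
    have hp : p = 0 := by
      by_contra hp
      exact hE.false (j, ⟨0, Nat.pos_of_ne_zero hp⟩)
    subst hp
    simp [fold, zigzag]
  obtain ⟨e⟩ : Nonempty (Fin d × Fin p ↪ Fin n) :=
    Function.Embedding.nonempty_of_card_le (by simpa using h)
  -- A unit outside the range of `e` copies some other unit and is ignored by the readout.
  let q : Fin n → Fin d × Fin p := Function.invFun e
  have hq : ∀ a, q (e a) = a := Function.leftInverse_invFun e.injective
  refine ⟨fun r c => if (q r).1 = c then 1 else 0, fun r => -((q r).2 : ℕ) / p,
    fun c r => ∑ k : Fin p, if e (c, k) = r then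
      (if (k : ℕ) = 0 then (p : ℝ) else 2 * p * (-1) ^ (k : ℕ)) else 0, fun y => ?_⟩
  funext j
  simp only [Matrix.mulVec, dotProduct, rectifier, fold, zigzag, Finset.sum_mul, Pi.add_apply,
    ite_mul, zero_mul, one_mul]
  rw [Finset.sum_comm, Finset.sum_range]
  refine Finset.sum_congr rfl fun k _ => ?_
  simp [hq, sub_eq_add_neg, neg_div]

/-! ### Sign patterns of monic polynomials -/

/-- The sign at the `i`-th node of a monic polynomial with one simple root immediately after the
`s`-th node for each `s ∈ S`, and no other root right of the first node. -/
noncomputable def signPattern {n : ℕ} (S : Finset (Fin n)) (i : Fin n) : ℝ :=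
  ∏ s ∈ S, if i ≤ s then -1 else 1

theorem signPattern_eq_or {n : ℕ} (S : Finset (Fin n)) (i : Fin n) :
    signPattern S i = 1 ∨ signPattern S i = -1 :=
  Finset.prod_induction _ (fun a : ℝ => a = 1 ∨ a = -1)
    (by rintro a b (rfl | rfl) (rfl | rfl) <;> norm_num) (Or.inl rfl)
    (fun s _ => by split_ifs <;> simp)

theorem signPattern_injective {n : ℕ} :
    Function.Injective (signPattern : Finset (Fin n) → Fin n → ℝ) := by
  intro S S' h
  -- Membership of `m` is read off from the sign at `m` once it is known for all larger nodes.
  have split : ∀ (S : Finset (Fin n)) (m : Fin n), signPattern S m =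
      (if m ∈ S then -1 else 1) * ∏ s ∈ Finset.univ.erase m, if s ∈ S ∧ m ≤ s then -1 else 1 := by
    intro S m
    have h1 : signPattern S m = ∏ s, if s ∈ S ∧ m ≤ s then (-1 : ℝ) else 1 := by
      rw [signPattern, ← Finset.prod_filter_mul_prod_filter_not Finset.univ (· ∈ S)]
      rw [Finset.prod_eq_one (s := Finset.univ.filter (· ∉ S)), mul_one]
      · rw [Finset.filter_mem_eq_inter, Finset.univ_inter]
        exact Finset.prod_congr rfl fun s hs => by simp [hs]
      · intro s hs
        simp [(Finset.mem_filter.1 hs).2]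
    rw [h1, ← Finset.mul_prod_erase _ _ (Finset.mem_univ m)]
    simp
  have key : ∀ m : Fin n, m ∈ S ↔ m ∈ S' := by
    intro m
    induction m using WellFoundedGT.induction with
    | ind m ih =>
      have hprod : (∏ s ∈ Finset.univ.erase m, if s ∈ S ∧ m ≤ s then (-1 : ℝ) else 1) =
          ∏ s ∈ Finset.univ.erase m, if s ∈ S' ∧ m ≤ s then (-1 : ℝ) else 1 := by
        refine Finset.prod_congr rfl fun s hs => ?_
        have hsm := Finset.ne_of_mem_erase hs
        by_cases hms : m ≤ s
        · simp only [ih s (lt_of_le_of_ne hms hsm.symm)]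
        · simp [hms]
      have hne : (∏ s ∈ Finset.univ.erase m, if s ∈ S' ∧ m ≤ s then (-1 : ℝ) else 1) ≠ 0 :=
        Finset.prod_ne_zero_iff.2 fun s _ => by split_ifs <;> norm_num
      have h1 := congrFun h m
      rw [split, split, hprod] at h1
      have h2 := mul_right_cancel₀ hne h1
      by_cases hS : m ∈ S <;> by_cases hS' : m ∈ S' <;> simp [hS, hS'] at h2 ⊢ <;> norm_num at h2
  exact Finset.ext key

/-- The value at `t` of the monic polynomial of degree `d` with lower coefficients `y`. -/
def monicEval {d : ℕ} (y : Fin d → ℝ) (t : ℝ) : ℝ := t ^ d + ∑ j, y j * t ^ (j : ℕ)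

theorem exists_monicEval_eq_eval {d : ℕ} {P : Polynomial ℝ} (hP : P.Monic) (hd : P.natDegree = d) :
    ∃ y : Fin d → ℝ, ∀ t, monicEval y t = P.eval t := by
  refine ⟨fun j => P.coeff j, fun t => ?_⟩
  rw [Polynomial.eval_eq_sum_range, hd, Finset.sum_range_succ, ← hd, hP.coeff_natDegree, hd,
    Finset.sum_range, monicEval, one_mul, add_comm]

/-- Every sign pattern coming from at most `d` roots is attained at equally spaced nodes: the roots
are put half a step after the nodes in `S`, and the remaining ones left of all nodes. -/
theorem exists_monicEval_sign {d n : ℕ} (δ : ℝ) (S : Finset (Fin n)) (hS : S.card ≤ d) :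
    ∃ y : Fin d → ℝ, ∀ i : Fin n, 0 < signPattern S i * monicEval y (δ + (i : ℕ)) := by
  let P : Polynomial ℝ := (∏ s ∈ S, (Polynomial.X - Polynomial.C (δ + (s : ℕ) + 1 / 2))) *
    (Polynomial.X - Polynomial.C (δ - 1)) ^ (d - S.card)
  have hm1 : (∏ s ∈ S, (Polynomial.X - Polynomial.C (δ + ((s : ℕ) : ℝ) + 1 / 2))).Monic :=
    Polynomial.monic_prod_of_monic _ _ fun s _ => Polynomial.monic_X_sub_C _
  have hm2 : ((Polynomial.X - Polynomial.C (δ - 1)) ^ (d - S.card)).Monic :=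
    (Polynomial.monic_X_sub_C _).pow _
  have hdeg : P.natDegree = d := by
    rw [hm1.natDegree_mul hm2, Polynomial.natDegree_prod_of_monic _ _
      fun s _ => Polynomial.monic_X_sub_C _, (Polynomial.monic_X_sub_C _).natDegree_pow]
    simp only [Polynomial.natDegree_X_sub_C, Finset.sum_const, smul_eq_mul, mul_one]
    omega
  obtain ⟨y, hy⟩ := exists_monicEval_eq_eval (hm1.mul hm2) hdeg
  refine ⟨y, fun i => ?_⟩
  rw [hy, signPattern, Polynomial.eval_mul, Polynomial.eval_prod, ← mul_assoc,
    ← Finset.prod_mul_distrib]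
  refine mul_pos (Finset.prod_pos fun s _ => ?_) ?_
  · simp only [Polynomial.eval_sub, Polynomial.eval_X, Polynomial.eval_C]
    split_ifs with his
    · have : ((i : ℕ) : ℝ) ≤ (s : ℕ) := by exact_mod_cast his
      linarith
    · have : ((s : ℕ) : ℝ) + 1 ≤ (i : ℕ) := by exact_mod_cast (not_le.1 his)
      linarith
  · simp only [Polynomial.eval_pow, Polynomial.eval_sub, Polynomial.eval_X, Polynomial.eval_C]
    refine pow_pos ?_ _
    have : (0 : ℝ) ≤ (i : ℕ) := Nat.cast_nonneg _
    linarith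

theorem finite_setOf_sum_mul_pow_eq_zero {d : ℕ} {c : Fin d → ℝ} (hc : c ≠ 0) :
    {t : ℝ | ∑ j, c j * t ^ (j : ℕ) = 0}.Finite := by
  by_contra hinf
  let P : Polynomial ℝ := ∑ j, Polynomial.C (c j) * Polynomial.X ^ (j : ℕ)
  have hP : P = 0 := by
    refine Polynomial.eq_zero_of_infinite_isRoot P ?_
    convert hinf using 3 with t
    simp [P, Polynomial.IsRoot, Polynomial.eval_finsetSum]
  refine hc (funext fun j => ?_)
  have := congrArg (fun Q => Polynomial.coeff Q (j : ℕ)) hP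
  simpa [P, Polynomial.finsetSum_coeff, Polynomial.coeff_X_pow, Fin.val_inj] using this

/-! ### The last layer -/

/-- A generic linear combination keeps finitely many distinct tuples apart, since a real vector
space is not a finite union of proper subspaces. -/
theorem exists_injective_sum_smul {κ V : Type*} [Finite κ] [AddCommGroup V] [Module ℝ V] {n : ℕ}
    {v : κ → Fin n → V} (hv : Function.Injective v) :
    ∃ a : Fin n → ℝ, Function.Injective fun k => ∑ i, a i • v k i := by
  let N : {q : κ × κ // q.1 ≠ q.2} → Subspace ℝ (Fin n → ℝ) := fun q =>
    LinearMap.ker (Fintype.linearCombination ℝ (v q.1.1 - v q.1.2))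
  have hN : ∀ q, N q ≠ ⊤ := by
    rintro ⟨⟨k, l⟩, hkl⟩ htop
    refine hkl (hv (funext fun i => ?_))
    have h1 : Pi.single i 1 ∈ N ⟨(k, l), hkl⟩ := by rw [htop]; trivial
    have h2 := LinearMap.mem_ker.1 h1
    rw [Fintype.linearCombination_apply_single, one_smul] at h2
    exact sub_eq_zero.1 h2
  have hcover : ⋃ q, (N q : Set (Fin n → ℝ)) ≠ Set.univ := fun h =>
    (Subspace.exists_eq_top_of_iUnion_eq_univ h).elim hN
  obtain ⟨a, ha⟩ := (Set.ne_univ_iff_exists_notMem _).1 hcover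
  refine ⟨a, fun k l hkl => ?_⟩
  by_contra hne
  refine ha (Set.mem_iUnion.2 ⟨⟨(k, l), hne⟩, LinearMap.mem_ker.2 ?_⟩)
  rw [Fintype.linearCombination_apply]
  simp only [Pi.sub_apply, smul_sub, Finset.sum_sub_distrib]
  exact sub_eq_zero.2 hkl

theorem card_subtype_card_le (n d : ℕ) :
    Fintype.card {S : Finset (Fin n) // S.card ≤ d} = ∑ j ∈ Finset.range (d + 1), n.choose j := by
  rw [Fintype.card_subtype, Finset.card_eq_sum_card_fiberwise (f := Finset.card)
    (t := Finset.range (d + 1))]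
  · refine Finset.sum_congr rfl fun j hj => ?_
    have h : (Finset.univ.filter fun S : Finset (Fin n) => S.card ≤ d).filter (·.card = j) =
        Finset.powersetCard j Finset.univ := by
      ext S
      have := Finset.mem_range.1 hj
      simp [Finset.mem_powersetCard]
      omega
    rw [h, Finset.card_powersetCard, Finset.card_univ, Fintype.card_fin]
  · intro S hS
    simpa [Nat.lt_succ_iff] using hS

/-- The units of the last layer are chosen so that, as functions of a point of the cube, they are
`±(t_i ^ d + ∑ j, y_j * t_i ^ j)` where `y` runs through a large box. Their sign patterns are those
of monic polynomials of degree `d` at the nodes `t_i`, which have all patterns with at most `d` sign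
changes. The signs `±` are those for which a unit is inactive on the alternating pattern; so, if
`d < n`, there is an active unit everywhere, and this unit tells the pieces of `Φ` apart. -/
theorem exists_last_layer {d n : ℕ} {Φ : (Fin d → ℝ) → (Fin d → ℝ)}
    {T : Set ((Fin d → ℝ) ≃ᵃ[ℝ] (Fin d → ℝ))} (hT : T ⊆ cubePieces Φ) (hfin : T.Finite)
    (h : T.Subsingleton ∨ d < n) :
    ∃ (W : Matrix (Fin n) (Fin d) ℝ) (b : Fin n → ℝ) (a : Fin n → ℝ)
      (v : T × {S : Finset (Fin n) // S.card ≤ d} → Fin n → (Fin d → ℝ) →ᵃ[ℝ] ℝ),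
      (∀ k, ∃ x, ∀ᶠ x' in 𝓝 x, ∀ i, rectifier (W *ᵥ Φ x' + b) i = v k i x') ∧
      Function.Injective fun k => ∑ i, a i • v k i := by
  classical
  have : Finite T := hfin
  -- Nodes at which distinct pieces of `Φ` give distinct affine functions.
  let bad : T × T → Set ℝ := fun q =>
    {t | q.1 ≠ q.2 ∧ ∀ x, ∑ j, (q.1.1 x j - q.2.1 x j) * t ^ (j : ℕ) = 0}
  have hbad : ∀ q, (bad q).Finite := by
    rintro ⟨g, g'⟩
    by_cases hg : g = g'
    · simp [bad, hg]
    · have : ∃ x, g.1 x ≠ g'.1 x := by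
        by_contra! hx
        exact hg (Subtype.ext (AffineEquiv.ext hx))
      obtain ⟨x, hx⟩ := this
      exact (finite_setOf_sum_mul_pow_eq_zero (sub_ne_zero.2 hx)).subset fun t ht => ht.2 x
  obtain ⟨δ₀, hδ₀⟩ := (Set.finite_iUnion hbad).bddAbove
  let t : Fin n → ℝ := fun i => δ₀ + 1 + (i : ℕ)
  have ht : ∀ (g g' : T) i, g ≠ g' → ∃ x, ∑ j, (g.1 x j - g'.1 x j) * t i ^ (j : ℕ) ≠ 0 := by
    intro g g' i hg
    by_contra! hx
    have h1 : t i ≤ δ₀ := hδ₀ (Set.mem_iUnion.2 ⟨(g, g'), hg, hx⟩)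
    have h2 : (0 : ℝ) ≤ (i : ℕ) := Nat.cast_nonneg _
    simp only [t] at h1
    linarith
  have hy : ∀ S : {S : Finset (Fin n) // S.card ≤ d}, ∃ y : Fin d → ℝ,
      ∀ i, 0 < signPattern S.1 i * monicEval y (t i) := fun S =>
    exists_monicEval_sign (δ₀ + 1) S.1 S.2
  choose y hy using hy
  -- The box of side `R` centred at `0` contains the coefficients `y S` of all sign patterns.
  obtain ⟨R₀, hR₀⟩ := (Set.finite_range fun q : {S : Finset (Fin n) // S.card ≤ d} × Fin d =>
    |y q.1 q.2|).bddAbove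
  let R : ℝ := 2 * (|R₀| + 1)
  have hR : 0 < R := by positivity
  have hyR : ∀ S j, |y S j / R| < 1 / 2 := by
    intro S j
    have h1 : |y S j| ≤ R₀ := hR₀ ⟨(S, j), rfl⟩
    rw [abs_div, abs_of_pos hR, div_lt_iff₀ hR]
    simp only [R]
    linarith [le_abs_self R₀]
  let z : {S : Finset (Fin n) // S.card ≤ d} → Fin d → ℝ := fun S j => y S j / R + 1 / 2
  have hz : ∀ S, z S ∈ openCube d := fun S j => by
    have := abs_lt.1 (hyR S j)
    constructor <;> simp only [z] <;> linarith [this.1, this.2]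
  let σ : Fin n → ℝ := fun i => -signPattern Finset.univ i
  have hσ : ∀ i, σ i = 1 ∨ σ i = -1 := fun i => by
    rcases signPattern_eq_or (Finset.univ : Finset (Fin n)) i with h | h <;> simp [σ, h]
  let W : Matrix (Fin n) (Fin d) ℝ := fun i j => σ i * (R * t i ^ (j : ℕ))
  let b : Fin n → ℝ := fun i => σ i * (t i ^ d - ∑ j : Fin d, R / 2 * t i ^ (j : ℕ))
  have hWb : ∀ u i, (W *ᵥ u + b) i = σ i * monicEval (fun j => R * (u j - 1 / 2)) (t i) := by
    intro u i
    simp only [Pi.add_apply, Matrix.mulVec, dotProduct, W, b, monicEval]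
    rw [add_comm, mul_add, mul_sub, sub_add, sub_eq_add_neg, Finset.mul_sum, Finset.mul_sum,
      ← Finset.sum_sub_distrib, ← Finset.sum_neg_distrib]
    congr 1
    exact Finset.sum_congr rfl fun j _ => by ring
  let ℓ : Fin n → (Fin d → ℝ) →ᵃ[ℝ] ℝ := fun i =>
    (LinearMap.proj i ∘ₗ W.mulVecLin).toAffineMap + AffineMap.const ℝ (Fin d → ℝ) (b i)
  have hℓ : ∀ u i, (W *ᵥ u + b) i = ℓ i u := fun u i => rfl
  have hsign : ∀ S i, 0 < (signPattern S.1 i * σ i) * ℓ i (z S) := by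
    intro S i
    rw [← hℓ, hWb]
    have h1 : (fun j => R * (z S j - 1 / 2)) = y S := by
      funext j
      simp only [z, add_sub_cancel_right]
      exact mul_div_cancel₀ _ hR.ne'
    have h2 : σ i * σ i = 1 := by rcases hσ i with h | h <;> rw [h] <;> norm_num
    rw [h1, mul_assoc, ← mul_assoc (σ i), h2, one_mul]
    exact hy S i
  let v : T × {S : Finset (Fin n) // S.card ≤ d} → Fin n → (Fin d → ℝ) →ᵃ[ℝ] ℝ := fun k i =>
    if signPattern k.2.1 i = σ i then (ℓ i).comp k.1.1.toAffineMap else 0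
  let pt : T × {S : Finset (Fin n) // S.card ≤ d} → Fin d → ℝ := fun k => k.1.1.symm (z k.2)
  have hpt : ∀ k : T × {S : Finset (Fin n) // S.card ≤ d}, k.1.1 (pt k) = z k.2 := fun k =>
    k.1.1.apply_symm_apply _
  have hpos : ∀ (k : T × {S : Finset (Fin n) // S.card ≤ d}) i,
      signPattern k.2.1 i = σ i → 0 < ℓ i (z k.2) := by
    intro k i hk
    have h1 := hsign k.2 i
    rw [hk] at h1
    rcases hσ i with h | h <;> rw [h] at h1 <;> linarith
  have hneg : ∀ (k : T × {S : Finset (Fin n) // S.card ≤ d}) i,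
      signPattern k.2.1 i ≠ σ i → ℓ i (z k.2) < 0 := by
    intro k i hk
    have h1 := hsign k.2 i
    rcases hσ i with h | h <;> rcases signPattern_eq_or k.2.1 i with h' | h' <;>
      rw [h, h'] at hk h1 <;> first | exact absurd rfl hk | linarith
  have hgerm : ∀ k, ∀ᶠ x' in 𝓝 (pt k), ∀ i, rectifier (W *ᵥ Φ x' + b) i = v k i x' := by
    intro k
    have hΦ : Φ =ᶠ[𝓝 (pt k)] k.1.1 := (hT k.1.2 (pt k) (by rw [hpt]; exact hz _)).2
    refine Filter.eventually_all.2 fun i => ?_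
    have hcont : ContinuousAt (fun x' => ℓ i (k.1.1 x')) (pt k) :=
      ((ℓ i).continuous_of_finiteDimensional.comp (AffineEquiv.continuous_pi k.1.1)).continuousAt
    by_cases hk : signPattern k.2.1 i = σ i
    · have h1 := hcont.eventually_const_lt (u := 0) (by simpa only [hpt] using hpos k i hk)
      filter_upwards [hΦ, h1] with x' hx' hx''
      simp only [rectifier, hℓ, v, if_pos hk, hx']
      exact max_eq_right hx''.le
    · have h1 := hcont.eventually_lt_const (u := 0) (by simpa only [hpt] using hneg k i hk)
      filter_upwards [hΦ, h1] with x' hx' hx''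
      simp only [rectifier, hℓ, v, if_neg hk, hx']
      exact max_eq_left hx''.le
  have hactive : ∀ (k k' : T × {S : Finset (Fin n) // S.card ≤ d}) i,
      v k i = v k' i → signPattern k.2.1 i = σ i →
      signPattern k'.2.1 i = σ i := by
    intro k k' i hv hk
    by_contra hk'
    have h1 := congrArg (fun g : (Fin d → ℝ) →ᵃ[ℝ] ℝ => g (pt k)) hv
    simp only [v, if_pos hk, if_neg hk'] at h1
    have h2 : ℓ i (k.1.1 (pt k)) = 0 := h1
    rw [hpt] at h2
    exact (hpos k i hk).ne' h2
  have hvinj : Function.Injective v := by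
    intro k k' hv
    have hS : k.2 = k'.2 := by
      refine Subtype.ext (signPattern_injective (funext fun i => ?_))
      have h1 := hactive k k' i (congrFun hv i)
      have h2 := hactive k' k i (congrFun hv.symm i)
      rcases hσ i with h | h <;> rcases signPattern_eq_or k.2.1 i with h' | h' <;>
        rcases signPattern_eq_or k'.2.1 i with h'' | h'' <;> rw [h, h', h''] at h1 h2 <;>
        rw [h', h''] <;> first | exact h1 rfl | exact (h1 rfl).symm | exact h2 rfl
    refine Prod.ext ?_ hS
    rcases h with h | h
    · exact Subtype.ext (h k.1.2 k'.1.2)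
    -- Some unit is active, because `k.2` has at most `d < n` elements.
    have hex : ∃ i, signPattern k.2.1 i = σ i := by
      by_contra! hno
      have h1 : k.2.1 = Finset.univ := by
        refine signPattern_injective (funext fun i => ?_)
        have := hno i
        simp only [σ] at this
        rcases signPattern_eq_or k.2.1 i with h' | h' <;>
          rcases signPattern_eq_or (Finset.univ : Finset (Fin n)) i with h'' | h'' <;>
          rw [h', h''] at this ⊢ <;> norm_num at this
      have h2 := k.2.2
      rw [h1, Finset.card_univ, Fintype.card_fin] at h2
      omega
    obtain ⟨i, hi⟩ := hex
    have hi' := hactive k k' i (congrFun hv i) hi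
    by_contra hne
    obtain ⟨x, hx⟩ := ht k.1 k'.1 i hne
    have h1 := congrArg (fun g : (Fin d → ℝ) →ᵃ[ℝ] ℝ => g x) (congrFun hv i)
    simp only [v, if_pos hi, if_pos hi'] at h1
    have h2 : ℓ i (k.1.1 x) = ℓ i (k'.1.1 x) := h1
    rw [← hℓ, ← hℓ, hWb, hWb] at h2
    have h3 := mul_left_cancel₀ (by rcases hσ i with h | h <;> rw [h] <;> norm_num) h2
    simp only [monicEval, add_right_inj] at h3
    rw [← sub_eq_zero, ← Finset.sum_sub_distrib] at h3
    refine hx (mul_left_cancel₀ hR.ne' ?_)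
    rw [mul_zero, ← h3, Finset.mul_sum]
    exact Finset.sum_congr rfl fun j _ => by ring
  obtain ⟨a, ha⟩ := exists_injective_sum_smul hvinj
  exact ⟨W, b, a, v, fun k => ⟨pt k, hgerm k⟩, ha⟩

/-! ### The network -/

theorem AffineMap.finsetSum_apply {ι E : Type*} [AddCommGroup E] [Module ℝ E] (s : Finset ι)
    (f : ι → E →ᵃ[ℝ] ℝ) (x : E) : (∑ i ∈ s, f i) x = ∑ i ∈ s, f i x :=
  map_sum (AddMonoidHom.mk' (fun g : E →ᵃ[ℝ] ℝ => g x) fun _ _ => rfl) f s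

/-- The composition of the folding maps that the first `l` layers, of widths `n 1, …, n l`, can
compute. -/
noncomputable def iteratedFold (n : ℕ → ℕ) : ℕ → (Fin (n 0) → ℝ) → (Fin (n 0) → ℝ)
  | 0 => id
  | l + 1 => fold (n 0) (n (l + 1) / n 0) ∘ iteratedFold n l

theorem prod_le_encard_cubePieces_iteratedFold (n : ℕ → ℕ) (hn0 : 1 ≤ n 0) (l : ℕ) :
    ((∏ i ∈ Finset.Icc 1 l, (n i / n 0) ^ n 0 : ℕ) : ℕ∞) ≤
      (cubePieces (iteratedFold n l)).encard := by
  induction l with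
  | zero =>
    simp only [Finset.Icc_eq_empty_of_lt zero_lt_one, Finset.prod_empty, Nat.cast_one,
      Set.one_le_encard_iff_nonempty]
    exact ⟨AffineEquiv.refl ℝ _, fun x hx => ⟨hx, Filter.EventuallyEq.rfl⟩⟩
  | succ l ih =>
    rw [Finset.prod_Icc_succ_top (by omega), Nat.cast_mul, mul_comm]
    exact (mul_le_mul' (le_encard_cubePieces_fold _ _ hn0) ih).trans (encard_cubePieces_comp _ _)

/-- The readout of each folding layer is merged into the weights of the next layer, so that the
last of `K + 1` layers acts on the iterated folding map by arbitrary prescribed parameters. -/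
theorem exists_activation_eq (n : ℕ → ℕ) (K : ℕ) (W : Matrix (Fin (n (K + 1))) (Fin (n 0)) ℝ)
    (b : Fin (n (K + 1)) → ℝ) :
    ∃ θ : HiddenParams n, ∀ x,
      θ.activation (K + 1) x = rectifier (W *ᵥ iteratedFold n K x + b) := by
  choose W' b' B hB using fun l => exists_layer_eq_fold (Nat.mul_div_le (n (l + 1)) (n 0))
  let readout : (l : ℕ) → Matrix (Fin (n 0)) (Fin (n l)) ℝ
    | 0 => 1
    | l + 1 => B l
  let θ : HiddenParams n :=
    { W := Function.update (fun l => W' l * readout l) K (W * readout K)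
      b := Function.update b' K b }
  have hθ : ∀ l ≤ K, ∀ x, readout l *ᵥ θ.activation l x = iteratedFold n l x := by
    intro l
    induction l with
    | zero => exact fun _ x => Matrix.one_mulVec x
    | succ l ih =>
      intro hl x
      have hlK : l ≠ K := by omega
      simp only [HiddenParams.activation, θ, Function.update_of_ne hlK]
      rw [← Matrix.mulVec_mulVec]
      rw [ih (by omega) x]
      exact hB l _
  refine ⟨θ, fun x => ?_⟩
  rw [← hθ K le_rfl x, Matrix.mulVec_mulVec]
  simp only [HiddenParams.activation, θ, Function.update_self]

theorem mainTheorem1 (n : ℕ → ℕ) (L : ℕ) (hL : 1 ≤ L) (hn0 : 1 ≤ n 0)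
    (hn : ∀ i ∈ Finset.Icc 1 L, n 0 ≤ n i)
    (hlast : (∃ i ∈ Finset.Icc 1 (L - 1), 2 * n 0 ≤ n i) → n 0 < n L) :
    ∃ θ : HiddenParams n,
      (((∏ i ∈ Finset.Icc 1 (L - 1), (n i / n 0) ^ n 0) *
          ∑ j ∈ Finset.range (n 0 + 1), (n L).choose j : ℕ) : ℕ∞) ≤
        numLinearRegions (θ.activation L) ∧
      ∀ m : ℕ, 1 ≤ m → ∃ (A : Matrix (Fin m) (Fin (n L)) ℝ) (c : Fin m → ℝ),
        (((∏ i ∈ Finset.Icc 1 (L - 1), (n i / n 0) ^ n 0) *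
            ∑ j ∈ Finset.range (n 0 + 1), (n L).choose j : ℕ) : ℕ∞) ≤
          numLinearRegions (θ.networkFun L A c) := by
  obtain ⟨K, rfl⟩ : ∃ K, L = K + 1 := ⟨L - 1, by omega⟩
  rw [Nat.add_sub_cancel] at *
  obtain ⟨T, hT, hTcard⟩ :=
    Set.exists_subset_encard_eq (prod_le_encard_cubePieces_iteratedFold n hn0 K)
  have hcase : T.Subsingleton ∨ n 0 < n (K + 1) := by
    by_cases hex : ∃ i ∈ Finset.Icc 1 K, 2 * n 0 ≤ n i
    · exact Or.inr (hlast hex)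
    · push Not at hex
      refine Or.inl (Set.encard_le_one_iff_subsingleton.1 ?_)
      rw [hTcard]
      refine Nat.cast_le_one.2 (Finset.prod_le_one' fun i hi => pow_le_one' ?_ _)
      have := Nat.div_lt_of_lt_mul ((hex i hi).trans_eq (mul_comm _ _))
      omega
  obtain ⟨W, b, a, v, hgerm, hinj⟩ :=
    exists_last_layer hT (Set.finite_of_encard_eq_coe hTcard) hcase
  obtain ⟨θ, hθ⟩ := exists_activation_eq n K W b
  rw [Nat.cast_mul, ← hTcard, ← card_subtype_card_le, ← ENat.card_eq_coe_fintype_card,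
    ← ENat.card_coe_set_eq, ← ENat.card_prod]
  refine ⟨θ, ?_, fun m hm => ⟨fun _ i => a i, 0, ?_⟩⟩
  · refine card_le_numLinearRegions (fun k => AffineMap.pi (v k)) (fun k k' hkk => hinj ?_)
      fun k => ?_
    · refine Finset.sum_congr rfl fun i _ => ?_
      have : v k i = v k' i := AffineMap.ext fun x => congrFun (DFunLike.congr_fun hkk x) i
      rw [this]
    · obtain ⟨x, hx⟩ := hgerm k
      refine ⟨x, hx.mono fun x' hx' => funext fun i => ?_⟩
      rw [hθ, hx']
      rfl
  · refine card_le_numLinearRegions (fun k => AffineMap.pi fun _ => ∑ i, a i • v k i)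
      (fun k k' hkk => hinj ?_) fun k => ?_
    · exact AffineMap.ext fun x => congrFun (DFunLike.congr_fun hkk x) ⟨0, hm⟩
    · obtain ⟨x, hx⟩ := hgerm k
      refine ⟨x, hx.mono fun x' hx' => funext fun i => ?_⟩
      simp only [HiddenParams.networkFun, add_zero, Matrix.mulVec, dotProduct, hθ, hx',
        AffineMap.pi_apply, AffineMap.finsetSum_apply]
      rfl
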